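/- For an $n\times n$ complex matrix $Z$, let $\sigma_1(Z)\ge\sigma_2(Z)\ge\dots\ge\sigma_n(Z)\ge 0$ denote its singular values, arranged in non-increasing order. Let $f:[0,\infty)\to[0,\infty)$ be a concave function with $f(0)=0$, and let $X,Y$ be arbitrary $n\times n$ complex matrices. Then for every $m\le n$ and every strictly increasing sequence $i_1<i_2<\dots<i_m$ of integers in $\{1,\dots,n\}$, $$\sum_{k=1}^m \bigl|f(\sigma_{i_k}(X))-f(\sigma_{i_k}(Y))\bigr|\;\le\;\sum_{k=1}^m f(\sigma_k(X-Y)).$$ -/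

import Mathlib

open Module InnerProductSpace

/-! On a finite set of points `f` agrees with a nonnegative combination of the functions `min · t`
(`ConcaveOn.exists_eq_sum_mul_min`), so it suffices to treat `min · t`.

Let `z k` be the singular values of `Z = X - Y`, indexed from 0. If `t ≤ z m`, every term on the
right equals `t` and the bound is trivial. Otherwise let `r ≤ m` be the number of `z k` above `t`,
and pass through `W = Y + C`, where `C` keeps the singular directions `r ≤ k < m` of `Z` with values
lowered to `z k - z m`. From `Y` to `W` the singular values move in total by at most the trace norm
of `C`. On a subspace of codimension at most `r`, `X - W` has norm at most `z m`, so the singular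
values of `X` and `W` interlace with shift `r` and error `z m`; a telescoping argument
(`sum_abs_min_sub_min_le_of_interlacing`) bounds their truncated differences by `m * z m + r * (t -
z m)`. The two costs add up to exactly the right-hand side.

The trace norm bound is proved one rank-one term at a time, using the self-adjoint dilation and
monotonicity of eigenvalues. -/

theorem Submodule.exists_ne_zero_mem_of_finrank_lt {K V : Type*} [DivisionRing K] [AddCommGroup V]
    [Module K V] [FiniteDimensional K V] (M N : Submodule K V)
    (h : finrank K V < finrank K M + finrank K N) : ∃ x ∈ M, x ∈ N ∧ x ≠ 0 := by
  have h1 := Submodule.finrank_sup_add_finrank_inf_eq M N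
  have h2 := Submodule.finrank_le (M ⊔ N)
  have h3 : M ⊓ N ≠ ⊥ := by
    intro h0
    rw [h0, finrank_bot] at h1
    omega
  obtain ⟨x, hx, hx0⟩ := Submodule.exists_mem_ne_zero_of_ne_bot h3
  exact ⟨x, hx.1, hx.2, hx0⟩

theorem Submodule.le_finrank_inf_add {K V : Type*} [DivisionRing K] [AddCommGroup V]
    [Module K V] [FiniteDimensional K V] {M N : Submodule K V} {a b : ℕ}
    (hM : finrank K V ≤ finrank K M + a) (hN : finrank K V ≤ finrank K N + b) :
    finrank K V ≤ finrank K ↥(M ⊓ N) + (a + b) := by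
  have h1 := Submodule.finrank_sup_add_finrank_inf_eq M N
  have h2 := Submodule.finrank_le (M ⊔ N)
  omega

/-! ### Min-max bounds for eigenvalues of symmetric operators -/

section

variable {𝕜 : Type*} [RCLike 𝕜]
  {E : Type*} [NormedAddCommGroup E] [InnerProductSpace 𝕜 E] {n : ℕ}

theorem OrthonormalBasis.finrank_span_image (b : OrthonormalBasis (Fin n) 𝕜 E)
    (s : Finset (Fin n)) : finrank 𝕜 (Submodule.span 𝕜 (b '' s)) = s.card := by
  have h := b.toBasis.linearIndependent.comp (fun i : s => (i : Fin n)) Subtype.val_injective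
  have h2 := finrank_span_eq_card h
  rw [Fintype.card_coe] at h2
  have h3 : Set.range (fun i : s => (i : Fin n)) = s := Subtype.range_coe
  rw [← h2, Set.range_comp, h3, OrthonormalBasis.coe_toBasis]

theorem OrthonormalBasis.repr_eq_zero_of_mem_span_image (b : OrthonormalBasis (Fin n) 𝕜 E)
    {s : Finset (Fin n)} {x : E} (hx : x ∈ Submodule.span 𝕜 (b '' s)) {j : Fin n} (hj : j ∉ s) :
    b.repr x j = 0 := by
  have h : x ∈ Submodule.span 𝕜 (b.toBasis '' s) := by simpa using hx
  have := (Module.Basis.mem_span_image b.toBasis).1 h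
  by_contra h0
  apply hj
  have : j ∈ (b.toBasis.repr x).support := by
    simpa [Finsupp.mem_support_iff] using h0
  exact_mod_cast (Module.Basis.mem_span_image b.toBasis).1 h this

theorem OrthonormalBasis.sum_sq_norm_repr (b : OrthonormalBasis (Fin n) 𝕜 E) (x : E) :
    ∑ j, ‖b.repr x j‖ ^ 2 = ‖x‖ ^ 2 := by
  rw [← b.repr.norm_map x, EuclideanSpace.norm_sq_eq]

variable [FiniteDimensional 𝕜 E]

namespace LinearMap.IsSymmetric

variable {T : E →ₗ[𝕜] E} (hT : T.IsSymmetric) (hn : finrank 𝕜 E = n)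

theorem re_inner_apply_self_eq_sum (x : E) :
    RCLike.re ⟪T x, x⟫_𝕜
      = ∑ j, hT.eigenvalues hn j * ‖(hT.eigenvectorBasis hn).repr x j‖ ^ 2 := by
  rw [← (hT.eigenvectorBasis hn).repr.inner_map_map, PiLp.inner_apply, map_sum]
  refine Finset.sum_congr rfl fun j _ => ?_
  rw [hT.eigenvectorBasis_apply_self_apply hn, RCLike.inner_apply, (starRingEnd 𝕜).map_mul,
    RCLike.conj_ofReal, mul_left_comm, RCLike.mul_conj]
  norm_cast

theorem exists_submodule_re_inner_le (i : Fin n) :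
    ∃ M : Submodule 𝕜 E, n ≤ finrank 𝕜 M + i ∧
      ∀ x ∈ M, RCLike.re ⟪T x, x⟫_𝕜 ≤ hT.eigenvalues hn i * ‖x‖ ^ 2 := by
  refine ⟨Submodule.span 𝕜 (hT.eigenvectorBasis hn '' (Finset.Ici i : Finset (Fin n))), ?_, ?_⟩
  · rw [OrthonormalBasis.finrank_span_image, Fin.card_Ici]
    omega
  · intro x hx
    rw [hT.re_inner_apply_self_eq_sum hn, ← (hT.eigenvectorBasis hn).sum_sq_norm_repr x,
      Finset.mul_sum]
    refine Finset.sum_le_sum fun j _ => ?_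
    by_cases hj : i ≤ j
    · exact mul_le_mul_of_nonneg_right (hT.eigenvalues_antitone hn hj) (by positivity)
    · rw [(hT.eigenvectorBasis hn).repr_eq_zero_of_mem_span_image hx (by simpa using hj)]
      simp

theorem exists_submodule_le_re_inner (i : Fin n) :
    ∃ M : Submodule 𝕜 E, (i : ℕ) < finrank 𝕜 M ∧
      ∀ x ∈ M, hT.eigenvalues hn i * ‖x‖ ^ 2 ≤ RCLike.re ⟪T x, x⟫_𝕜 := by
  refine ⟨Submodule.span 𝕜 (hT.eigenvectorBasis hn '' (Finset.Iic i : Finset (Fin n))), ?_, ?_⟩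
  · rw [OrthonormalBasis.finrank_span_image, Fin.card_Iic]
    omega
  · intro x hx
    rw [hT.re_inner_apply_self_eq_sum hn, ← (hT.eigenvectorBasis hn).sum_sq_norm_repr x,
      Finset.mul_sum]
    refine Finset.sum_le_sum fun j _ => ?_
    by_cases hj : j ≤ i
    · exact mul_le_mul_of_nonneg_right (hT.eigenvalues_antitone hn hj) (by positivity)
    · rw [(hT.eigenvectorBasis hn).repr_eq_zero_of_mem_span_image hx (by simpa using hj)]
      simp

theorem eigenvalues_le_of_submodule (i : Fin n) {M : Submodule 𝕜 E} {c : ℝ}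
    (hM : n ≤ finrank 𝕜 M + i) (h : ∀ x ∈ M, RCLike.re ⟪T x, x⟫_𝕜 ≤ c * ‖x‖ ^ 2) :
    hT.eigenvalues hn i ≤ c := by
  obtain ⟨N, hN, hN'⟩ := hT.exists_submodule_le_re_inner hn i
  obtain ⟨x, hxM, hxN, hx⟩ := Submodule.exists_ne_zero_mem_of_finrank_lt M N (by omega)
  have : 0 < ‖x‖ ^ 2 := by positivity
  exact le_of_mul_le_mul_right ((hN' x hxN).trans (h x hxM)) this

theorem le_eigenvalues_of_submodule (i : Fin n) {M : Submodule 𝕜 E} {c : ℝ}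
    (hM : (i : ℕ) < finrank 𝕜 M) (h : ∀ x ∈ M, c * ‖x‖ ^ 2 ≤ RCLike.re ⟪T x, x⟫_𝕜) :
    c ≤ hT.eigenvalues hn i := by
  obtain ⟨N, hN, hN'⟩ := hT.exists_submodule_re_inner_le hn i
  obtain ⟨x, hxM, hxN, hx⟩ := Submodule.exists_ne_zero_mem_of_finrank_lt M N (by omega)
  have : 0 < ‖x‖ ^ 2 := by positivity
  exact le_of_mul_le_mul_right ((h x hxM).trans (hN' x hxN)) this

theorem eigenvalues_mono {S : E →ₗ[𝕜] E} (hS : S.IsSymmetric)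
    (h : ∀ x, RCLike.re ⟪T x, x⟫_𝕜 ≤ RCLike.re ⟪S x, x⟫_𝕜) (i : Fin n) :
    hT.eigenvalues hn i ≤ hS.eigenvalues hn i := by
  obtain ⟨N, hN, hN'⟩ := hT.exists_submodule_le_re_inner hn i
  exact hS.le_eigenvalues_of_submodule hn i hN fun x hx => (hN' x hx).trans (h x)

/-- Each eigenvalue of the common upper bound `R` dominates those of `T` and `S`, so the distance
between the latter is at most the sum of their two gaps to `R`. Summed over all indices, the gaps
become traces. -/
theorem sum_abs_eigenvalues_sub_le {S R : E →ₗ[𝕜] E} (hS : S.IsSymmetric) (hR : R.IsSymmetric)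
    (hTR : ∀ x, RCLike.re ⟪T x, x⟫_𝕜 ≤ RCLike.re ⟪R x, x⟫_𝕜)
    (hSR : ∀ x, RCLike.re ⟪S x, x⟫_𝕜 ≤ RCLike.re ⟪R x, x⟫_𝕜) :
    ∑ i, |hT.eigenvalues hn i - hS.eigenvalues hn i|
      ≤ RCLike.re ((R - T).trace 𝕜 E) + RCLike.re ((R - S).trace 𝕜 E) := by
  rw [map_sub, map_sub, map_sub, map_sub, hT.re_trace_eq_sum_eigenvalues hn,
    hS.re_trace_eq_sum_eigenvalues hn, hR.re_trace_eq_sum_eigenvalues hn,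
    ← Finset.sum_sub_distrib, ← Finset.sum_sub_distrib, ← Finset.sum_add_distrib]
  refine Finset.sum_le_sum fun i _ => ?_
  have h1 := hT.eigenvalues_mono hn hR hTR i
  have h2 := hS.eigenvalues_mono hn hR hSR i
  rw [abs_le]
  constructor <;> linarith

end LinearMap.IsSymmetric

/-! ### Min-max bounds for singular values -/

namespace LinearMap

variable (T : E →ₗ[𝕜] E)

theorem re_inner_adjoint_comp_self_apply (x : E) :
    RCLike.re ⟪(adjoint T ∘ₗ T) x, x⟫_𝕜 = ‖T x‖ ^ 2 := by
  rw [comp_apply, adjoint_inner_left, inner_self_eq_norm_sq]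

theorem exists_submodule_norm_apply_le (i : ℕ) :
    ∃ M : Submodule 𝕜 E, finrank 𝕜 E ≤ finrank 𝕜 M + i ∧
      ∀ x ∈ M, ‖T x‖ ≤ T.singularValues i * ‖x‖ := by
  rcases lt_or_ge i (finrank 𝕜 E) with hi | hi
  · obtain ⟨M, hM, h⟩ := T.isSymmetric_adjoint_comp_self.exists_submodule_re_inner_le rfl ⟨i, hi⟩
    refine ⟨M, hM, fun x hx => ?_⟩
    have := h x hx
    rw [re_inner_adjoint_comp_self_apply, ← T.sq_singularValues_of_lt rfl hi, ← mul_pow] at this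
    exact le_of_sq_le_sq this (mul_nonneg (T.singularValues_nonneg i) (norm_nonneg x))
  · exact ⟨⊥, by omega, fun x hx => by simp [(Submodule.mem_bot 𝕜).1 hx]⟩

theorem exists_submodule_le_norm_apply {i : ℕ} (hi : i < finrank 𝕜 E) :
    ∃ M : Submodule 𝕜 E, i < finrank 𝕜 M ∧ ∀ x ∈ M, T.singularValues i * ‖x‖ ≤ ‖T x‖ := by
  obtain ⟨M, hM, h⟩ := T.isSymmetric_adjoint_comp_self.exists_submodule_le_re_inner rfl ⟨i, hi⟩
  refine ⟨M, hM, fun x hx => ?_⟩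
  have := h x hx
  rw [re_inner_adjoint_comp_self_apply, ← T.sq_singularValues_of_lt rfl hi, ← mul_pow] at this
  exact le_of_sq_le_sq this (norm_nonneg _)

theorem singularValues_le_of_submodule {i : ℕ} {M : Submodule 𝕜 E} {c : ℝ} (hc : 0 ≤ c)
    (hM : finrank 𝕜 E ≤ finrank 𝕜 M + i) (h : ∀ x ∈ M, ‖T x‖ ≤ c * ‖x‖) :
    T.singularValues i ≤ c := by
  rcases lt_or_ge i (finrank 𝕜 E) with hi | hi
  · obtain ⟨N, hN, hN'⟩ := T.exists_submodule_le_norm_apply hi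
    obtain ⟨x, hxM, hxN, hx⟩ := Submodule.exists_ne_zero_mem_of_finrank_lt M N (by omega)
    exact le_of_mul_le_mul_right ((hN' x hxN).trans (h x hxM)) (norm_pos_iff.2 hx)
  · rwa [T.singularValues_of_finrank_le hi]

/-- Weyl's inequality with the perturbation controlled only on `M`: intersecting `M` with a subspace
optimal for `S` costs at most `r` further dimensions. -/
theorem singularValues_add_le {S : E →ₗ[𝕜] E} {r : ℕ} {M : Submodule 𝕜 E} {s : ℝ} (hs : 0 ≤ s)
    (hM : finrank 𝕜 E ≤ finrank 𝕜 M + r) (h : ∀ x ∈ M, ‖T x - S x‖ ≤ s * ‖x‖) (i : ℕ) :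
    T.singularValues (i + r) ≤ S.singularValues i + s := by
  obtain ⟨N, hN, hN'⟩ := S.exists_submodule_norm_apply_le i
  refine T.singularValues_le_of_submodule (add_nonneg (S.singularValues_nonneg i) hs)
    (Submodule.le_finrank_inf_add hN hM) fun x hx => ?_
  have h1 := hN' x hx.1
  have h2 := h x hx.2
  have h3 := norm_add_le (S x) (T x - S x)
  rw [add_sub_cancel] at h3
  linarith

end LinearMap

end

/-! ### Self-adjoint dilation and the trace norm perturbation bound -/

section

variable {𝕜 : Type*} [RCLike 𝕜]
  {E : Type*} [NormedAddCommGroup E] [InnerProductSpace 𝕜 E]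

theorem WithLp.finrank_prod_self [FiniteDimensional 𝕜 E] {n : ℕ} (hn : finrank 𝕜 E = n) :
    finrank 𝕜 (WithLp 2 (E × E)) = n + n := by
  rw [(WithLp.linearEquiv 2 𝕜 (E × E)).finrank_eq, Module.finrank_prod, hn]

theorem WithLp.finrank_add_finrank_le_finrank_comap_snd [FiniteDimensional 𝕜 E]
    (N : Submodule 𝕜 E) :
    finrank 𝕜 E + finrank 𝕜 N ≤ finrank 𝕜 (N.comap
      (LinearMap.snd 𝕜 E E ∘ₗ (WithLp.linearEquiv 2 𝕜 (E × E)).toLinearMap)) := by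
  let g : E × N →ₗ[𝕜] WithLp 2 (E × E) :=
    (WithLp.linearEquiv 2 𝕜 (E × E)).symm.toLinearMap ∘ₗ LinearMap.id.prodMap N.subtype
  have hg : Function.Injective g := by
    apply (WithLp.linearEquiv 2 𝕜 (E × E)).symm.injective.comp
    exact Function.Injective.prodMap Function.injective_id N.subtype_injective
  rw [← Module.finrank_prod, ← LinearMap.finrank_range_of_inj hg]
  apply Submodule.finrank_mono
  rintro _ ⟨x, rfl⟩
  exact x.2.2

variable [FiniteDimensional 𝕜 E]

namespace LinearMap

/-- The self-adjoint dilation of `T`, with block matrix `[0, T; T†, 0]`. -/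
noncomputable def dilation (T : E →ₗ[𝕜] E) : WithLp 2 (E × E) →ₗ[𝕜] WithLp 2 (E × E) :=
  (WithLp.linearEquiv 2 𝕜 (E × E)).symm.toLinearMap ∘ₗ
    (T ∘ₗ LinearMap.snd 𝕜 E E).prod (adjoint T ∘ₗ LinearMap.fst 𝕜 E E) ∘ₗ
      (WithLp.linearEquiv 2 𝕜 (E × E)).toLinearMap

theorem adjoint_toLinearMap_rankOne (u v : E) :
    adjoint (rankOne 𝕜 u v).toLinearMap = (rankOne 𝕜 v u).toLinearMap := by
  refine ((eq_adjoint_iff _ _).2 fun x y => ?_).symm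
  simp only [ContinuousLinearMap.coe_coe, rankOne_apply, inner_smul_left, inner_smul_right,
    inner_conj_symm]
  ring

variable (T : E →ₗ[𝕜] E)

@[simp]
theorem dilation_apply_fst (x : WithLp 2 (E × E)) : (T.dilation x).fst = T x.snd := rfl

@[simp]
theorem dilation_apply_snd (x : WithLp 2 (E × E)) : (T.dilation x).snd = adjoint T x.fst := rfl

theorem isSymmetric_dilation : T.dilation.IsSymmetric := by
  intro x y
  simp only [WithLp.prod_inner_apply, WithLp.ofLp_fst, WithLp.ofLp_snd, dilation_apply_fst,
    dilation_apply_snd, adjoint_inner_left, adjoint_inner_right]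
  ring

theorem re_inner_dilation_apply_self (x : WithLp 2 (E × E)) :
    RCLike.re ⟪T.dilation x, x⟫_𝕜 = 2 * RCLike.re ⟪T x.snd, x.fst⟫_𝕜 := by
  simp only [WithLp.prod_inner_apply, WithLp.ofLp_fst, WithLp.ofLp_snd, dilation_apply_fst,
    dilation_apply_snd, adjoint_inner_left, map_add]
  rw [← inner_conj_symm, RCLike.conj_re, two_mul]

/-- With `ε = 1` this bounds the top eigenvalues of the dilation from below; with `ε = -1`, the
bottom ones from above. The vectors `(ε T y, σ y)` imitate the eigenvectors belonging to `ε σ`. -/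
theorem exists_submodule_le_re_inner_dilation {i : ℕ} (hi : i < finrank 𝕜 E) {ε : ℝ}
    (hε : ε ^ 2 = 1) :
    ∃ M : Submodule 𝕜 (WithLp 2 (E × E)), i < finrank 𝕜 M ∧
      ∀ x ∈ M, T.singularValues i * ‖x‖ ^ 2 ≤ ε * RCLike.re ⟪T.dilation x, x⟫_𝕜 := by
  obtain ⟨V, hV, h⟩ := T.exists_submodule_le_norm_apply hi
  set σ := T.singularValues i with hσ
  rcases (T.singularValues_nonneg i).eq_or_lt' with h0 | h0
  -- For `σ = 0` the map `y ↦ (ε T y, σ y)` need not be injective; on vectors `(0, y)` the form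
  -- vanishes, which is enough.
  · let g : E →ₗ[𝕜] WithLp 2 (E × E) :=
      (WithLp.linearEquiv 2 𝕜 (E × E)).symm.toLinearMap ∘ₗ LinearMap.inr 𝕜 E E
    have hg : Function.Injective g :=
      (WithLp.linearEquiv 2 𝕜 (E × E)).symm.injective.comp LinearMap.inr_injective
    refine ⟨V.map g, by rwa [(Submodule.equivMapOfInjective g hg V).symm.finrank_eq], ?_⟩
    rintro _ ⟨y, hy, rfl⟩
    have h1 : (g y).fst = 0 := rfl
    rw [re_inner_dilation_apply_self, h1, hσ, h0]
    simp
  · let g : E →ₗ[𝕜] WithLp 2 (E × E) :=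
      (WithLp.linearEquiv 2 𝕜 (E × E)).symm.toLinearMap ∘ₗ
        ((ε : 𝕜) • T).prod ((σ : 𝕜) • LinearMap.id)
    have hg1 : ∀ y, (g y).fst = (ε : 𝕜) • T y := fun y => rfl
    have hg2 : ∀ y, (g y).snd = (σ : 𝕜) • y := fun y => rfl
    have hg : Function.Injective g := by
      intro y z hyz
      have : (σ : 𝕜) • y = (σ : 𝕜) • z := by rw [← hg2, ← hg2, hyz]
      exact smul_right_injective E (RCLike.ofReal_ne_zero.2 h0.ne') this
    refine ⟨V.map g, by rwa [(Submodule.equivMapOfInjective g hg V).symm.finrank_eq], ?_⟩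
    rintro _ ⟨y, hy, rfl⟩
    have h2 : (σ * ‖y‖) ^ 2 ≤ ‖T y‖ ^ 2 :=
      pow_le_pow_left₀ (mul_nonneg h0.le (norm_nonneg y)) (h y hy) 2
    have h3 : |ε| ^ 2 = 1 := by rw [sq_abs, hε]
    rw [re_inner_dilation_apply_self, WithLp.prod_norm_sq_eq_of_L2, hg1, hg2, map_smul,
      inner_smul_left, inner_smul_right, norm_smul, norm_smul, RCLike.norm_ofReal,
      RCLike.norm_ofReal, RCLike.conj_ofReal, RCLike.re_ofReal_mul, RCLike.re_ofReal_mul,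
      inner_self_eq_norm_sq, mul_pow, h3, mul_pow, sq_abs]
    have h4 : ε * (2 * (σ * (ε * ‖T y‖ ^ 2))) = σ * (2 * ‖T y‖ ^ 2) := by
      linear_combination 2 * σ * ‖T y‖ ^ 2 * hε
    rw [h4]
    exact mul_le_mul_of_nonneg_left (by linarith) h0.le

/-- Constraining the second component alone suffices: Cauchy–Schwarz and `2ab ≤ a² + b²` absorb the
free first component. -/
theorem exists_submodule_abs_re_inner_dilation_le (i : ℕ) :
    ∃ M : Submodule 𝕜 (WithLp 2 (E × E)), finrank 𝕜 E + finrank 𝕜 E ≤ finrank 𝕜 M + i ∧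
      ∀ x ∈ M, |RCLike.re ⟪T.dilation x, x⟫_𝕜| ≤ T.singularValues i * ‖x‖ ^ 2 := by
  obtain ⟨N, hN, h⟩ := T.exists_submodule_norm_apply_le i
  have h1 := WithLp.finrank_add_finrank_le_finrank_comap_snd N
  refine ⟨_, (by omega : _ ≤ finrank 𝕜 (N.comap
    (LinearMap.snd 𝕜 E E ∘ₗ (WithLp.linearEquiv 2 𝕜 (E × E)).toLinearMap)) + i), fun x hx => ?_⟩
  have h2 : ‖T x.snd‖ ≤ _ := h x.snd hx
  have h0 := T.singularValues_nonneg i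
  rw [re_inner_dilation_apply_self, WithLp.prod_norm_sq_eq_of_L2, abs_mul, abs_two]
  calc 2 * |RCLike.re ⟪T x.snd, x.fst⟫_𝕜| ≤ 2 * (‖T x.snd‖ * ‖x.fst‖) := by
        gcongr
        exact (RCLike.abs_re_le_norm _).trans (norm_inner_le_norm _ _)
    _ ≤ 2 * (T.singularValues i * ‖x.snd‖ * ‖x.fst‖) := by gcongr
    _ = T.singularValues i * (2 * ‖x.fst‖ * ‖x.snd‖) := by ring
    _ ≤ _ := mul_le_mul_of_nonneg_left (two_mul_le_add_sq _ _) h0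

theorem eigenvalues_dilation_castAdd {n : ℕ} (hn : finrank 𝕜 E = n) (i : Fin n) :
    T.isSymmetric_dilation.eigenvalues (WithLp.finrank_prod_self hn) (Fin.castAdd n i)
      = T.singularValues i := by
  apply le_antisymm
  · obtain ⟨M, hM, h⟩ := T.exists_submodule_abs_re_inner_dilation_le i
    exact T.isSymmetric_dilation.eigenvalues_le_of_submodule _ _ (M := M)
      (by rw [hn] at hM; simpa using hM) fun x hx => (le_abs_self _).trans (h x hx)
  · obtain ⟨M, hM, h⟩ :=
      T.exists_submodule_le_re_inner_dilation (i := i) (by omega) (one_pow 2)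
    exact T.isSymmetric_dilation.le_eigenvalues_of_submodule _ _ (M := M)
      (by simpa using hM) fun x hx => by simpa using h x hx

theorem eigenvalues_dilation_natAdd {n : ℕ} (hn : finrank 𝕜 E = n) (i : Fin n) :
    T.isSymmetric_dilation.eigenvalues (WithLp.finrank_prod_self hn) (Fin.natAdd n i)
      = -T.singularValues i.rev := by
  apply le_antisymm
  · obtain ⟨M, hM, h⟩ :=
      T.exists_submodule_le_re_inner_dilation (i := i.rev) (by omega) (ε := -1) (by norm_num)
    refine T.isSymmetric_dilation.eigenvalues_le_of_submodule _ _ (M := M)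
      ?_ fun x hx => ?_
    · rw [Fin.val_rev] at hM
      rw [Fin.val_natAdd]
      omega
    · have := h x hx
      linarith
  · obtain ⟨M, hM, h⟩ := T.exists_submodule_abs_re_inner_dilation_le i.rev
    refine T.isSymmetric_dilation.le_eigenvalues_of_submodule _ _ (M := M)
      ?_ fun x hx => ?_
    · rw [Fin.val_rev, hn] at hM
      rw [Fin.val_natAdd]
      omega
    · have := (abs_le.1 (h x hx)).1
      linarith

theorem sum_abs_eigenvalues_dilation_sub {n : ℕ} (hn : finrank 𝕜 E = n) (S : E →ₗ[𝕜] E) :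
    ∑ i, |T.isSymmetric_dilation.eigenvalues (WithLp.finrank_prod_self hn) i
        - S.isSymmetric_dilation.eigenvalues (WithLp.finrank_prod_self hn) i|
      = 2 * ∑ i : Fin n, |T.singularValues i - S.singularValues i| := by
  rw [Fin.sum_univ_add, two_mul]
  congr 1
  · simp only [eigenvalues_dilation_castAdd _ hn]
  · simp only [eigenvalues_dilation_natAdd _ hn]
    rw [← Equiv.sum_comp Fin.revPerm]
    refine Finset.sum_congr rfl fun i _ => ?_
    rw [Fin.revPerm_apply, Fin.rev_rev, neg_sub_neg, abs_sub_comm]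

/-- The dilation of `c u v†` is a difference `P - Q` of positive operators of trace at most `c`.
Hence `T.dilation + P = S.dilation + Q` is a common upper bound, and the total eigenvalue
displacement is at most `2c`; each singular value occurs twice, with both signs. -/
theorem sum_abs_singularValues_sub_add_rankOne_le_of_norm_le_one {n : ℕ}
    (hn : finrank 𝕜 E = n) {u v : E} (hu : ‖u‖ ≤ 1)
    (hv : ‖v‖ ≤ 1) {c : ℝ} (hc : 0 ≤ c) :
    ∑ i : Fin n, |T.singularValues i
        - (T + (c : 𝕜) • (rankOne 𝕜 u v).toLinearMap).singularValues i| ≤ c := by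
  set S := T + (c : 𝕜) • (rankOne 𝕜 u v).toLinearMap with hS
  set p : WithLp 2 (E × E) := WithLp.toLp 2 (u, v) with hp
  set q : WithLp 2 (E × E) := WithLp.toLp 2 (u, -v) with hq
  set P := ((c / 2 : ℝ) : 𝕜) • (rankOne 𝕜 p p).toLinearMap with hP
  set Q := ((c / 2 : ℝ) : 𝕜) • (rankOne 𝕜 q q).toLinearMap with hQ
  have hhalf : (((c / 2 : ℝ) : 𝕜)) = c / 2 := by push_cast; rfl
  have key : T.dilation + P = S.dilation + Q := by
    refine LinearMap.ext fun x => WithLp.ofLp_injective 2 (Prod.ext ?_ ?_)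
    · simp only [WithLp.ofLp_fst, add_apply, WithLp.add_fst, dilation_apply_fst, hS, hP, hQ, hhalf,
        smul_apply, WithLp.smul_fst, ContinuousLinearMap.coe_coe, rankOne_apply, hp, hq,
        WithLp.prod_inner_apply, inner_neg_left, WithLp.toLp_fst, WithLp.ofLp_snd]
      module
    · simp only [WithLp.ofLp_snd, add_apply, WithLp.add_snd, dilation_apply_snd, hS, hP, hQ, hhalf,
        smul_apply, WithLp.smul_snd, ContinuousLinearMap.coe_coe, rankOne_apply, hp, hq, map_add,
        WithLp.prod_inner_apply, inner_neg_left, WithLp.toLp_snd, WithLp.ofLp_fst, map_smulₛₗ,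
        RCLike.conj_ofReal, adjoint_toLinearMap_rankOne]
      module
  have hpos (r x : WithLp 2 (E × E)) : 0 ≤ RCLike.re
      ⟪(((c / 2 : ℝ) : 𝕜) • (rankOne 𝕜 r r).toLinearMap) x, x⟫_𝕜 := by
    rw [smul_apply, ContinuousLinearMap.coe_coe, rankOne_apply, inner_smul_left, inner_smul_left,
      RCLike.conj_ofReal, RCLike.re_ofReal_mul, RCLike.conj_mul]
    norm_cast
    positivity
  have hsym (r : WithLp 2 (E × E)) :
      (((c / 2 : ℝ) : 𝕜) • (rankOne 𝕜 r r).toLinearMap).IsSymmetric := by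
    intro x y
    simp only [smul_apply, ContinuousLinearMap.coe_coe, rankOne_apply, inner_smul_left,
      inner_smul_right, RCLike.conj_ofReal, inner_conj_symm]
    ring
  have htr (r : WithLp 2 (E × E)) (hr : ‖r‖ ^ 2 ≤ 2) : RCLike.re
      ((((c / 2 : ℝ) : 𝕜) • (rankOne 𝕜 r r).toLinearMap).trace 𝕜 _) ≤ c := by
    rw [map_smul, trace_rankOne, smul_eq_mul, RCLike.re_ofReal_mul, inner_self_eq_norm_sq]
    nlinarith
  have h := T.isSymmetric_dilation.sum_abs_eigenvalues_sub_le (WithLp.finrank_prod_self hn)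
    S.isSymmetric_dilation (T.isSymmetric_dilation.add (hsym p)) (fun x => by
      rw [add_apply, inner_add_left, map_add]
      linarith [hpos p x]) (fun x => by
      rw [key, add_apply, inner_add_left, map_add]
      linarith [hpos q x])
  rw [sum_abs_eigenvalues_dilation_sub _ hn, add_sub_cancel_left, key, add_sub_cancel_left] at h
  have h1 := htr p (by
    rw [WithLp.prod_norm_sq_eq_of_L2, hp, WithLp.toLp_fst, WithLp.toLp_snd]
    nlinarith [norm_nonneg u, norm_nonneg v])
  have h2 := htr q (by
    rw [WithLp.prod_norm_sq_eq_of_L2, hq, WithLp.toLp_fst, WithLp.toLp_snd, norm_neg]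
    nlinarith [norm_nonneg u, norm_nonneg v])
  linarith

theorem sum_abs_singularValues_sub_add_rankOne_le {n : ℕ} (hn : finrank 𝕜 E = n) (u : E) {v : E}
    (hv : ‖v‖ ≤ 1) :
    ∑ i : Fin n, |T.singularValues i
        - (T + (rankOne 𝕜 u v).toLinearMap).singularValues i| ≤ ‖u‖ := by
  -- For `u = 0` the inverse is `0` by convention, so only `≤ 1` holds in general.
  have hu : ‖((‖u‖⁻¹ : ℝ) : 𝕜) • u‖ ≤ 1 := by
    rw [norm_smul, RCLike.norm_ofReal, abs_of_nonneg (by positivity)]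
    exact inv_mul_le_one
  have h := T.sum_abs_singularValues_sub_add_rankOne_le_of_norm_le_one hn hu hv (norm_nonneg u)
  have h2 : ((‖u‖ : ℝ) : 𝕜) • (rankOne 𝕜 (((‖u‖⁻¹ : ℝ) : 𝕜) • u) v).toLinearMap
      = (rankOne 𝕜 u v).toLinearMap := by
    ext x
    rcases eq_or_ne u 0 with rfl | h0
    · simp
    · have : (‖u‖ : 𝕜) ≠ 0 := by simpa using h0
      simp only [smul_apply, ContinuousLinearMap.coe_coe, rankOne_apply, smul_smul]
      congr 1
      push_cast
      field_simp
  rwa [h2] at h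

theorem sum_abs_singularValues_sub_add_sum_rankOne_le {n : ℕ} (hn : finrank 𝕜 E = n) {ι : Type*}
    (s : Finset ι) (u v : ι → E) (hv : ∀ k ∈ s, ‖v k‖ ≤ 1) :
    ∑ i : Fin n, |T.singularValues i
        - (T + ∑ k ∈ s, (rankOne 𝕜 (u k) (v k)).toLinearMap).singularValues i|
      ≤ ∑ k ∈ s, ‖u k‖ := by
  classical
  induction s using Finset.induction_on with
  | empty => simp
  | insert a s ha ih =>
    have h1 := ih fun k hk => hv k (Finset.mem_insert_of_mem hk)
    have h2 := (T + ∑ k ∈ s, (rankOne 𝕜 (u k) (v k)).toLinearMap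
      ).sum_abs_singularValues_sub_add_rankOne_le hn (u a) (hv a (Finset.mem_insert_self a s))
    rw [Finset.sum_insert ha, Finset.sum_insert ha, add_comm (rankOne 𝕜 (u a) (v a)).toLinearMap,
      ← add_assoc, add_comm ‖u a‖]
    refine le_trans ?_ (add_le_add h1 h2)
    rw [← Finset.sum_add_distrib]
    exact Finset.sum_le_sum fun i _ => abs_sub_le _ _ _

end LinearMap

end

/-! ### Scalar inequalities: interlacing sequences and concave functions -/

theorem sum_abs_min_sub_min_le_of_interlacing {a b : ℕ → ℝ} (ha : Antitone a) (hb : Antitone b)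
    (ha0 : ∀ i, 0 ≤ a i) (hb0 : ∀ i, 0 ≤ b i) {r : ℕ} {s t : ℝ} (hs : 0 ≤ s) (hst : s ≤ t)
    (hab : ∀ i, a (i + r) ≤ b i + s) (hba : ∀ i, b (i + r) ≤ a i + s) (I : Finset ℕ) :
    ∑ i ∈ I, |min (a i) t - min (b i) t| ≤ I.card * s + r * (t - s) := by
  -- `M` is the excess over `s` of the larger truncated term. Interlacing puts `M (i + r)` below the
  -- smaller truncated term at `i`, so each difference is at most `s + (M i - M (i + r))`; the sum
  -- telescopes to at most `r` values in `[0, t - s]`.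
  set M : ℕ → ℝ := fun i => max (min (max (a i) (b i)) t - s) 0 with hM
  have hM0 : ∀ i, 0 ≤ M i := fun i => le_max_right _ _
  have hMt : ∀ i, M i ≤ t - s := fun i =>
    max_le (sub_le_sub_right (min_le_right _ _) _) (sub_nonneg.2 hst)
  have hMr : ∀ i, M (i + r) ≤ M i := fun i =>
    max_le_max_right 0 (sub_le_sub_right (min_le_min_right t
      (max_le_max (ha (Nat.le_add_right i r)) (hb (Nat.le_add_right i r)))) s)
  have key : ∀ i, |min (a i) t - min (b i) t| ≤ s + (M i - M (i + r)) := by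
    intro i
    have h1 := hab i
    have h2 := hba i
    have h3 := ha (Nat.le_add_right i r)
    have h4 := hb (Nat.le_add_right i r)
    have h5 := ha0 i
    have h6 := hb0 i
    have h7 := hMr i
    simp only [hM] at h7 ⊢
    grind
  obtain ⟨N, hN⟩ := I.exists_nat_subset_range
  have hsum : ∑ i ∈ Finset.range N, (M i - M (i + r)) ≤ r * (t - s) := by
    have h1 := Finset.sum_range_add M r N
    have h2 := Finset.sum_range_add M N r
    rw [add_comm r N] at h1
    have h3 : ∑ i ∈ Finset.range r, M i ≤ r * (t - s) := by
      simpa using Finset.sum_le_card_nsmul (Finset.range r) M (t - s) fun i _ => hMt i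
    have h4 : 0 ≤ ∑ i ∈ Finset.range r, M (N + i) := Finset.sum_nonneg fun i _ => hM0 _
    simp only [add_comm r] at h1
    rw [Finset.sum_sub_distrib]
    linarith
  calc ∑ i ∈ I, |min (a i) t - min (b i) t| ≤ ∑ i ∈ I, (s + (M i - M (i + r))) :=
        Finset.sum_le_sum fun i _ => key i
    _ = I.card * s + ∑ i ∈ I, (M i - M (i + r)) := by
        rw [Finset.sum_add_distrib, Finset.sum_const, nsmul_eq_mul]
    _ ≤ I.card * s + ∑ i ∈ Finset.range N, (M i - M (i + r)) := by
        refine add_le_add_right ?_ _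
        exact Finset.sum_le_sum_of_subset_of_nonneg hN fun i _ _ => sub_nonneg.2 (hMr i)
    _ ≤ _ := by gcongr

theorem ConcaveOn.monotoneOn_Ici_of_nonneg {f : ℝ → ℝ} (hf : ConcaveOn ℝ (Set.Ici 0) f)
    (h0 : ∀ x, 0 ≤ x → 0 ≤ f x) : MonotoneOn f (Set.Ici 0) := by
  intro x hx y hy hxy
  rcases hxy.eq_or_lt with rfl | hxy
  · rfl
  by_contra! h
  rw [Set.mem_Ici] at hx hy
  have hd : 0 < (f x - f y) / (y - x) := div_pos (sub_pos.2 h) (sub_pos.2 hxy)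
  set d := (f x - f y) / (y - x) with hd'
  -- At `z` the chord through `x` and `y` has height `-1`, and concavity keeps `f` below it.
  set z := y + (f y + 1) / d with hz
  have hyz : y < z := by
    have := h0 y hy
    have : 0 < (f y + 1) / d := by positivity
    linarith
  have h1 := hf.slope_anti_adjacent (Set.mem_Ici.2 hx) (Set.mem_Ici.2 (hy.trans hyz.le)) hxy hyz
  have h2 : (f y - f x) / (y - x) = -d := by rw [hd', ← neg_div, neg_sub]
  have h3 : z - y = (f y + 1) / d := by rw [hz]; ring
  rw [h2, div_le_iff₀ (sub_pos.2 hyz), h3] at h1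
  have h4 : -d * ((f y + 1) / d) = -(f y + 1) := by field_simp
  have h5 := h0 z (hy.trans hyz.le)
  linarith

/-- The piecewise linear interpolant through the origin and the given points, constant after the
last node, has the drops in slope as its coefficients. Concavity makes the inner ones nonnegative,
monotonicity the last. -/
theorem ConcaveOn.exists_eq_sum_mul_min {f : ℝ → ℝ} (hf : ConcaveOn ℝ (Set.Ici 0) f)
    (h0 : ∀ x, 0 ≤ x → 0 ≤ f x) (hf0 : f 0 = 0) (S : Finset ℝ) (hS : ∀ x ∈ S, 0 ≤ x) :
    ∃ (T : Finset ℝ) (c : ℝ → ℝ), (∀ t ∈ T, 0 < t) ∧ (∀ t ∈ T, 0 ≤ c t) ∧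
      ∀ x ∈ S, f x = ∑ t ∈ T, c t * min x t := by
  have hmono := hf.monotoneOn_Ici_of_nonneg h0
  -- The last clause, that the coefficient at the largest node dominates all later chord slopes,
  -- keeps that coefficient nonnegative when a new node is added.
  suffices H : ∀ T : Finset ℝ, (∀ t ∈ T, 0 < t) → ∃ c : ℝ → ℝ, (∀ t ∈ T, 0 ≤ c t) ∧
      (∀ x ∈ T, f x = ∑ t ∈ T, c t * min x t) ∧
      ∀ m ∈ T, (∀ t ∈ T, t ≤ m) → ∀ y, m < y → (f y - f m) / (y - m) ≤ c m by
    obtain ⟨c, hc, h, -⟩ := H (S.filter (0 < ·)) (by simp)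
    refine ⟨S.filter (0 < ·), c, by simp, hc, fun x hx => ?_⟩
    rcases (hS x hx).eq_or_lt with rfl | hx0
    · rw [hf0, Finset.sum_eq_zero]
      intro t ht
      rw [min_eq_left (Finset.mem_filter.1 ht).2.le, mul_zero]
    · exact h x (Finset.mem_filter.2 ⟨hx, hx0⟩)
  intro T
  induction T using Finset.induction_on_max with
  | empty => exact fun _ => ⟨0, by simp⟩
  | insert q T hq ih =>
    intro hpos
    obtain ⟨c, hc, h, hm⟩ := ih fun t ht => hpos t (Finset.mem_insert_of_mem ht)
    have hq0 : 0 < q := hpos q (Finset.mem_insert_self q T)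
    have hqT : q ∉ T := fun h => lt_irrefl q (hq q h)
    rcases T.eq_empty_or_nonempty with rfl | hne
    · refine ⟨fun _ => f q / q, by simpa using div_nonneg (h0 q hq0.le) hq0.le, ?_, ?_⟩
      · simp [hq0.ne']
      · simp only [insert_empty_eq, Finset.mem_singleton, forall_eq, le_refl, forall_true_left]
        intro y hy
        have := hf.slope_anti_adjacent (Set.mem_Ici.2 le_rfl)
          (Set.mem_Ici.2 (hq0.trans hy).le) hq0 hy
        simpa [hf0] using this
    · set p := T.max' hne with hp
      have hpT : p ∈ T := T.max'_mem hne
      have hpq : p < q := hq p hpT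
      have hp0 : 0 < p := hpos p (Finset.mem_insert_of_mem hpT)
      have hqp : q ≠ p := hpq.ne'
      set d := (f q - f p) / (q - p) with hd
      have hd0 : 0 ≤ d := div_nonneg
        (sub_nonneg.2 (hmono (Set.mem_Ici.2 hp0.le) (Set.mem_Ici.2 hq0.le) hpq.le))
        (sub_nonneg.2 hpq.le)
      -- Moving weight `d` from `p` to `q` adds `d * (min x q - min x p)`: zero at the old nodes,
      -- and `f q - f p` at `q`.
      set c' : ℝ → ℝ := fun t => if t = q then d else c t - if t = p then d else 0 with hc'
      have hsum : ∀ x, ∑ t ∈ insert q T, c' t * min x t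
          = ∑ t ∈ T, c t * min x t + d * (min x q - min x p) := by
        intro x
        have h1 : ∑ t ∈ T, c' t * min x t
            = ∑ t ∈ T, (c t * min x t - if t = p then d * min x t else 0) := by
          refine Finset.sum_congr rfl fun t ht => ?_
          have : t ≠ q := fun h => hqT (h ▸ ht)
          simp only [hc', this, if_false]
          split_ifs <;> ring
        rw [Finset.sum_insert hqT, h1, Finset.sum_sub_distrib, Finset.sum_ite_eq' T p]
        simp only [hc', hpT, if_true]
        ring
      refine ⟨c', ?_, ?_, ?_⟩
      · intro t ht
        rcases Finset.mem_insert.1 ht with rfl | ht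
        · simpa [hc'] using hd0
        · have htq : t ≠ q := fun h => hqT (h ▸ ht)
          simp only [hc', htq, if_false]
          split_ifs with htp
          · rw [htp]
            exact sub_nonneg.2 (hm p hpT (fun t ht => T.le_max' t ht) q hpq)
          · simpa using hc t ht
      · intro x hx
        rw [hsum]
        rcases Finset.mem_insert.1 hx with rfl | hx
        · have h1 : ∑ t ∈ T, c t * min x t = f p := by
            rw [h p hpT]
            refine Finset.sum_congr rfl fun t ht => ?_
            rw [min_eq_right (hq t ht).le, min_eq_right (T.le_max' t ht)]
          rw [h1, min_self, min_eq_right hpq.le, hd, div_mul_cancel₀ _ (sub_pos.2 hpq).ne']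
          ring
        · rw [min_eq_left (hq x hx).le, min_eq_left (T.le_max' x hx), ← h x hx]
          ring
      · intro m hmT hmax y hy
        have : m = q := le_antisymm
          ((Finset.mem_insert.1 hmT).elim le_of_eq fun h => (hq m h).le)
          (hmax q (Finset.mem_insert_self q T))
        subst this
        have h1 : c' m = d := by simp [hc']
        rw [h1]
        exact hf.slope_anti_adjacent (Set.mem_Ici.2 hp0.le)
          (Set.mem_Ici.2 (hq0.trans hy).le) hpq hy

/-! ### The intermediate operator and the main inequality -/

namespace LinearMap

variable {𝕜 : Type*} [RCLike 𝕜]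
  {E : Type*} [NormedAddCommGroup E] [InnerProductSpace 𝕜 E] [FiniteDimensional 𝕜 E]

theorem exists_orthonormalBasis_norm_apply_sq (Z : E →ₗ[𝕜] E) {n : ℕ} (hn : finrank 𝕜 E = n) :
    ∃ b : OrthonormalBasis (Fin n) 𝕜 E,
      ∀ x, ‖Z x‖ ^ 2 = ∑ j : Fin n, (Z.singularValues j * ‖b.repr x j‖) ^ 2 := by
  refine ⟨Z.isSymmetric_adjoint_comp_self.eigenvectorBasis hn, fun x => ?_⟩
  rw [← re_inner_adjoint_comp_self_apply,
    Z.isSymmetric_adjoint_comp_self.re_inner_apply_self_eq_sum hn]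
  simp only [mul_pow, Z.sq_singularValues_fin hn]

theorem exists_sum_abs_singularValues_sub_le (Y Z : E →ₗ[𝕜] E) {n : ℕ} (hn : finrank 𝕜 E = n)
    (r m : ℕ) :
    ∃ W : E →ₗ[𝕜] E,
      ∑ i ∈ Finset.range n, |W.singularValues i - Y.singularValues i|
        ≤ ∑ k ∈ Finset.Ico r m, (Z.singularValues k - Z.singularValues m) ∧
      ∃ M : Submodule 𝕜 E, finrank 𝕜 E ≤ finrank 𝕜 M + r ∧
        ∀ x ∈ M, ‖(Y + Z) x - W x‖ ≤ Z.singularValues m * ‖x‖ := by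
  obtain ⟨b, hb⟩ := Z.exists_orthonormalBasis_norm_apply_sq hn
  set z : ℕ → ℝ := fun k => Z.singularValues k with hz
  have hz0 : ∀ k, 0 ≤ z k := Z.singularValues_nonneg
  have hza : Antitone z := Z.singularValues_antitone
  -- The fraction of the `k`-th singular component of `Z` moved into `W`; it leaves `min (z k) (z
  -- m)` for every `k ≥ r`. If `z k = 0` with `k < m`, then `z m = 0` too, so division by zero is
  -- harmless.
  set φ : ℕ → ℝ := fun k => if r ≤ k ∧ k < m then (z k - z m) / z k else 0 with hφ
  have hφz : ∀ k, z k * φ k = if r ≤ k ∧ k < m then z k - z m else 0 := by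
    intro k
    simp only [hφ]
    split_ifs with hk
    · rcases (hz0 k).eq_or_lt' with h0 | h0
      · have h1 := hza hk.2.le
        have h2 := hz0 m
        rw [h0, zero_mul]
        linarith
      · field_simp
    · rw [mul_zero]
  have hZb : ∀ k : Fin n, ‖Z (b k)‖ = z k := by
    intro k
    rw [← sq_eq_sq₀ (norm_nonneg _) (hz0 k), hb, Finset.sum_eq_single k]
    · simp [hz]
    · intro j _ hj
      simp [hj]
    · simp
  set C : E →ₗ[𝕜] E :=
    ∑ k : Fin n, (rankOne 𝕜 ((φ k : 𝕜) • Z (b k)) (b k)).toLinearMap with hC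
  have hφ0 : ∀ k, 0 ≤ z k * φ k := by
    intro k
    rw [hφz]
    split_ifs with hk
    · exact sub_nonneg.2 (hza hk.2.le)
    · rfl
  refine ⟨Y + C, ?_, Submodule.span 𝕜 (b '' (Finset.univ.filter fun k : Fin n => r ≤ k)),
    ?_, fun x hx => ?_⟩
  · have h := Y.sum_abs_singularValues_sub_add_sum_rankOne_le hn Finset.univ
      (fun k : Fin n => (φ k : 𝕜) • Z (b k)) b fun k _ => (b.norm_eq_one k).le
    rw [Finset.sum_range]
    simp only [abs_sub_comm ((Y + C).singularValues _)]
    refine h.trans ?_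
    have h1 : ∀ k : Fin n, ‖(φ k : 𝕜) • Z (b k)‖
        = if r ≤ (k : ℕ) ∧ (k : ℕ) < m then z k - z m else 0 := by
      intro k
      have h2 := abs_mul (z k) (φ k)
      rw [abs_of_nonneg (hφ0 k), abs_of_nonneg (hz0 k)] at h2
      rw [← hφz, h2, norm_smul, RCLike.norm_ofReal, hZb, mul_comm]
    simp only [h1]
    rw [← Finset.sum_range fun k => if r ≤ k ∧ k < m then z k - z m else 0, ← Finset.sum_filter]
    refine Finset.sum_le_sum_of_subset_of_nonneg ?_ fun k hk _ => ?_
    · intro k hk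
      exact Finset.mem_Ico.2 (Finset.mem_filter.1 hk).2
    · exact sub_nonneg.2 (hza (Finset.mem_Ico.1 hk).2.le)
  · rw [OrthonormalBasis.finrank_span_image, hn]
    have h1 := Finset.card_filter_add_card_filter_not (s := (Finset.univ : Finset (Fin n)))
      (fun k : Fin n => r ≤ k)
    have h2 : (Finset.univ.filter fun k : Fin n => ¬ r ≤ (k : ℕ)).card ≤ r := by
      have := Finset.card_le_card_of_injOn (s := Finset.univ.filter fun k : Fin n => ¬ r ≤ (k : ℕ))
        (t := Finset.range r) (fun k => (k : ℕ)) (fun k hk => by simpa using hk)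
        (Fin.val_injective.injOn)
      simpa using this
    rw [Finset.card_univ, Fintype.card_fin] at h1
    omega
  · have h1 : (Y + Z) x - (Y + C) x
        = Z (∑ k : Fin n, ((1 - φ k : ℝ) : 𝕜) • b.repr x k • b k) := by
      have h2 : Z x = ∑ k : Fin n, b.repr x k • Z (b k) := by
        conv_lhs => rw [← b.sum_repr x]
        simp
      rw [add_apply, add_apply, add_sub_add_left_eq_sub, h2, hC, map_sum, sum_apply,
        ← Finset.sum_sub_distrib]
      refine Finset.sum_congr rfl fun k _ => ?_
      rw [ContinuousLinearMap.coe_coe, rankOne_apply, ← b.repr_apply_apply, map_smul, map_smul]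
      push_cast
      module
    rw [h1, ← abs_norm, ← abs_of_nonneg (mul_nonneg (hz0 m) (norm_nonneg x)), ← sq_le_sq, hb,
      mul_pow, ← b.sum_sq_norm_repr x, Finset.mul_sum]
    refine Finset.sum_le_sum fun k _ => ?_
    have h3 : b.repr (∑ k : Fin n, ((1 - φ k : ℝ) : 𝕜) • b.repr x k • b k) k
        = ((1 - φ k : ℝ) : 𝕜) * b.repr x k := by
      simp [map_sum, Finset.sum_apply, Pi.single_apply]
    rw [h3, norm_mul, RCLike.norm_ofReal, ← mul_assoc, mul_pow]
    by_cases hk : r ≤ (k : ℕ)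
    · refine mul_le_mul_of_nonneg_right ?_ (by positivity)
      have h4 : z k * (1 - φ k) = min (z k) (z m) := by
        rw [mul_sub, hφz, mul_one]
        by_cases hkm : (k : ℕ) < m
        · rw [if_pos ⟨hk, hkm⟩, min_eq_right (hza hkm.le), sub_sub_cancel]
        · rw [if_neg fun h => hkm h.2, min_eq_left (hza (not_lt.1 hkm)), sub_zero]
      rw [mul_pow, sq_abs, ← mul_pow, h4]
      exact pow_le_pow_left₀ (le_min (hz0 _) (hz0 _)) (min_le_right _ _) 2
    · rw [b.repr_eq_zero_of_mem_span_image hx (by simpa using hk)]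
      simp

/-- The interlacing cost `m * z m + r * (t - z m)` and the trace norm cost `∑ (z k - z m)` over `r ≤
k < m` sum to `r * t + ∑ z k`, since the multiples of `z m` cancel. -/
theorem sum_abs_min_singularValues_sub_le (X Y : E →ₗ[𝕜] E) {t : ℝ} (ht : 0 ≤ t)
    {I : Finset ℕ} (hI : I ⊆ Finset.range (finrank 𝕜 E)) :
    ∑ i ∈ I, |min (X.singularValues i) t - min (Y.singularValues i) t|
      ≤ ∑ k ∈ Finset.range I.card, min ((X - Y).singularValues k) t := by
  set m := I.card with hm
  set z : ℕ → ℝ := fun k => (X - Y).singularValues k with hz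
  have hz0 : ∀ k, 0 ≤ z k := (X - Y).singularValues_nonneg
  have hza : Antitone z := (X - Y).singularValues_antitone
  rcases le_or_gt t (z m) with htm | htm
  · calc ∑ i ∈ I, |min (X.singularValues i) t - min (Y.singularValues i) t|
        ≤ ∑ i ∈ I, t := by
          refine Finset.sum_le_sum fun i _ => ?_
          have h1 := X.singularValues_nonneg i
          have h2 := Y.singularValues_nonneg i
          grind
      _ = ∑ k ∈ Finset.range m, t := by simp [hm]
      _ ≤ _ := Finset.sum_le_sum fun k hk =>
          le_min (htm.trans (hza (Finset.mem_range.1 hk).le)) le_rfl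
  · have hex : ∃ k, z k ≤ t := ⟨m, htm.le⟩
    classical
    -- `r` is the first index at which truncation at `t` no longer acts on `z`.
    obtain ⟨r, hr, hrm, hr'⟩ : ∃ r, z r ≤ t ∧ r ≤ m ∧ ∀ k < r, t < z k :=
      ⟨Nat.find hex, Nat.find_spec hex, Nat.find_min' hex htm.le,
        fun k hk => not_le.1 (Nat.find_min hex hk)⟩
    obtain ⟨W, hW, M, hM, hMW⟩ := exists_sum_abs_singularValues_sub_le Y (X - Y) rfl r m
    rw [add_sub_cancel] at hMW
    have h1 : ∑ i ∈ I, |min (X.singularValues i) t - min (W.singularValues i) t|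
        ≤ m * z m + r * (t - z m) :=
      sum_abs_min_sub_min_le_of_interlacing X.singularValues_antitone W.singularValues_antitone
        X.singularValues_nonneg W.singularValues_nonneg (hz0 m) htm.le
        (X.singularValues_add_le (hz0 m) hM hMW)
        (W.singularValues_add_le (hz0 m) hM fun x hx => by
          rw [norm_sub_rev]
          exact hMW x hx) I
    have h2 : ∑ i ∈ I, |min (W.singularValues i) t - min (Y.singularValues i) t|
        ≤ ∑ k ∈ Finset.Ico r m, (z k - z m) := by
      refine le_trans ?_ hW
      refine (Finset.sum_le_sum fun i _ => ?_).trans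
        (Finset.sum_le_sum_of_subset_of_nonneg hI fun i _ _ => abs_nonneg _)
      simpa using abs_min_sub_min_le_max (W.singularValues i) t (Y.singularValues i) t
    have h3 : ∑ k ∈ Finset.Ico r m, (z k - z m)
        = ∑ k ∈ Finset.Ico r m, z k - (m - r) * z m := by
      rw [Finset.sum_sub_distrib, Finset.sum_const, Nat.card_Ico, nsmul_eq_mul, Nat.cast_sub hrm]
    have h4 : ∑ k ∈ Finset.range m, min (z k) t = r * t + ∑ k ∈ Finset.Ico r m, z k := by
      rw [← Finset.sum_range_add_sum_Ico _ hrm]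
      congr 1
      · rw [Finset.sum_congr rfl fun k hk => min_eq_right (hr' k (Finset.mem_range.1 hk)).le]
        simp
      · exact Finset.sum_congr rfl fun k hk =>
          min_eq_left ((hza (Finset.mem_Ico.1 hk).1).trans hr)
    rw [h4]
    have h5 : ∑ i ∈ I, |min (X.singularValues i) t - min (Y.singularValues i) t|
        ≤ ∑ i ∈ I, |min (X.singularValues i) t - min (W.singularValues i) t|
          + ∑ i ∈ I, |min (W.singularValues i) t - min (Y.singularValues i) t| := by
      rw [← Finset.sum_add_distrib]
      exact Finset.sum_le_sum fun i _ => abs_sub_le _ _ _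
    linarith

theorem sum_abs_concave_singularValues_sub_le (X Y : E →ₗ[𝕜] E) {f : ℝ → ℝ}
    (hf : ConcaveOn ℝ (Set.Ici 0) f) (h0 : ∀ x, 0 ≤ x → 0 ≤ f x) (hf0 : f 0 = 0)
    {I : Finset ℕ} (hI : I ⊆ Finset.range (finrank 𝕜 E)) :
    ∑ i ∈ I, |f (X.singularValues i) - f (Y.singularValues i)|
      ≤ ∑ k ∈ Finset.range I.card, f ((X - Y).singularValues k) := by
  obtain ⟨T, c, hT, hc, h⟩ := hf.exists_eq_sum_mul_min h0 hf0
    (I.image X.singularValues ∪ I.image Y.singularValues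
      ∪ (Finset.range I.card).image (X - Y).singularValues) (by
    intro x hx
    simp only [Finset.mem_union, Finset.mem_image] at hx
    rcases hx with (⟨i, -, rfl⟩ | ⟨i, -, rfl⟩) | ⟨i, -, rfl⟩ <;> exact singularValues_nonneg _ _)
  have hX : ∀ i ∈ I, f (X.singularValues i) = ∑ t ∈ T, c t * min (X.singularValues i) t :=
    fun i hi => h _ (Finset.mem_union_left _ (Finset.mem_union_left _
      (Finset.mem_image_of_mem _ hi)))
  have hY : ∀ i ∈ I, f (Y.singularValues i) = ∑ t ∈ T, c t * min (Y.singularValues i) t :=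
    fun i hi => h _ (Finset.mem_union_left _ (Finset.mem_union_right _
      (Finset.mem_image_of_mem _ hi)))
  have hZ : ∀ k ∈ Finset.range I.card, f ((X - Y).singularValues k)
      = ∑ t ∈ T, c t * min ((X - Y).singularValues k) t :=
    fun k hk => h _ (Finset.mem_union_right _ (Finset.mem_image_of_mem _ hk))
  calc ∑ i ∈ I, |f (X.singularValues i) - f (Y.singularValues i)|
      ≤ ∑ i ∈ I, ∑ t ∈ T, c t * |min (X.singularValues i) t - min (Y.singularValues i) t| := by
        refine Finset.sum_le_sum fun i hi => ?_
        rw [hX i hi, hY i hi, ← Finset.sum_sub_distrib]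
        refine (Finset.abs_sum_le_sum_abs _ _).trans (Finset.sum_le_sum fun t ht => ?_)
        rw [← mul_sub, abs_mul, abs_of_nonneg (hc t ht)]
    _ = ∑ t ∈ T, c t * ∑ i ∈ I, |min (X.singularValues i) t - min (Y.singularValues i) t| := by
        rw [Finset.sum_comm]
        simp only [Finset.mul_sum]
    _ ≤ ∑ t ∈ T, c t * ∑ k ∈ Finset.range I.card, min ((X - Y).singularValues k) t :=
        Finset.sum_le_sum fun t ht => mul_le_mul_of_nonneg_left
          (sum_abs_min_singularValues_sub_le X Y (hT t ht).le hI) (hc t ht)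
    _ = ∑ k ∈ Finset.range I.card, f ((X - Y).singularValues k) := by
        rw [Finset.sum_congr rfl hZ, Finset.sum_comm]
        simp only [Finset.mul_sum]

end LinearMap

theorem theorem1 (f : ℝ → ℝ) (hf_concave : ConcaveOn ℝ (Set.Ici 0) f)
    (hf_nonneg : ∀ x : ℝ, 0 ≤ x → 0 ≤ f x) (hf_zero : f 0 = 0)
    (n : ℕ) (X Y : Matrix (Fin n) (Fin n) ℂ)
    (m : ℕ) (hm : m ≤ n) (i : Fin m → Fin n) (hi : StrictMono i) :
    ∑ k : Fin m, |f (X.toEuclideanLin.singularValues (i k : ℕ))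
        - f (Y.toEuclideanLin.singularValues (i k : ℕ))|
      ≤ ∑ k : Fin m, f ((X - Y).toEuclideanLin.singularValues (k : ℕ)) := by
  have hinj : Function.Injective fun k => (i k : ℕ) := Fin.val_injective.comp hi.injective
  have hI : Finset.univ.image (fun k => (i k : ℕ))
      ⊆ Finset.range (Module.finrank ℂ (EuclideanSpace ℂ (Fin n))) := by
    intro j hj
    obtain ⟨k, -, rfl⟩ := Finset.mem_image.1 hj
    simp
  have h := LinearMap.sum_abs_concave_singularValues_sub_le X.toEuclideanLin Y.toEuclideanLin
    hf_concave hf_nonneg hf_zero hI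
  rw [Finset.sum_image hinj.injOn, Finset.card_image_of_injective _ hinj, Finset.card_univ,
    Fintype.card_fin, Finset.sum_range, ← map_sub] at h
  exact h
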